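/- **Setting.** Regard $\mathbb Q$ as a difference field with $\sigma=\mathrm{id}$. For $a\ne 0$ in a difference field extension $E$ of $\mathbb Q$ and $p=\sum_k c_kx^k\in\mathbb Z[x]$ put $a^p=\prod_k(\sigma^k a)^{c_k}$. Let $\mathbb Q\{Y\}=\mathbb Q[\sigma^k y_i : 1\le i\le n,\ k\ge 0]$ be the difference ($\sigma$-) polynomial ring in $Y=\{y_1,\dots,y_n\}$, and write $[S]$ for the $\sigma$-ideal generated by $S$. A $\sigma$-variety over $\mathbb Q$ is a functor $\mathbb V(P)\colon E\mapsto\{\eta\in E^n : p(\eta)=0\ \forall p\in P\}$ on difference field extensions $E$ of $\mathbb Q$, with $P\subseteq\mathbb Q\{Y\}$; $\mathbb I(V)$ is the ideal of all $\sigma$-polynomials vanishing at all points of $V$. For a matrix $A=[\alpha_1,\dots,\alpha_n]\in\mathbb Z[x]^{m\times n}$ with columns $\alpha_i$, the quasi $\sigma$-torus $T_A$ is $E\mapsto\{(t^{\alpha_1},\dots,t^{\alpha_n}) : t\in(E^*)^m\}$; further $I_A=\{f\in\mathbb Q\{Y\} : f(T^{\alpha_1},\dots,T^{\alpha_n})=0\}$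 for $\sigma$-indeterminates $T=(t_1,\dots,t_m)$, $X_A=\mathbb V(I_A)$ and $\ker A=\{f\in\mathbb Z[x]^n : Af=0\}$. A $\sigma$-variety is *toric* if it is the Cohn closure of some $T_A$, i.e. the smallest $\sigma$-variety containing $T_A$ ($m\ge 0$ arbitrary, zero rows and columns of $A$ allowed). A $\mathbb Z[x]$-lattice $L\subseteq\mathbb Z[x]^n$ (a $\mathbb Z[x]$-submodule) is *toric*, or $\mathbb Z[x]$-saturated, if $pf\in L$ with $0\ne p\in\mathbb Z[x]$, $f\in\mathbb Z[x]^n$ implies $f\in L$. Put $I^+(L)=[Y^{f^+}-Y^{f^-} : f\in L]$, where $f^+,f^-\in\mathbb N[x]^n$ are the positive and negative parts of $f$; a *toric $\sigma$-ideal* is $I^+(L)$ with $L$ toric. The support lattice of a $\sigma$-ideal $I$ is $\mathbb L(I)=\{f\in\mathbb Z[x]^n : Y^{f^+}-cY^{f^-}\in I\text{ for some }c\in\mathbb Q^*\}$, and $L^C=\{f\in\mathbb Z[x]^n : \langle f,g\rangle=0\ \forall g\in L\}$ for the dot product. **Theorem.** Let $n\ge 0$. 1. A $\sigma$-variety $V$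 over $\mathbb Q$ in $\mathbb A^n$ is toric if and only if $\mathbb I(V)$ is a toric $\sigma$-ideal. Moreover, $V$ is the Cohn closure of $T_A$ for some $A$ with no zero row and no zero column if and only if $\mathbb I(V)=I^+(L)$ for a toric lattice $L$ containing none of the standard basis vectors of $\mathbb Z[x]^n$. 2. For every $A\in\mathbb Z[x]^{m\times n}$, $X_A$ is the Cohn closure of $T_A$, $\mathbb I(X_A)=I_A$, the lattice $\ker A$ is toric, $\mathbb I(X_A)=I^+(\ker A)$, and the support lattice of $\mathbb I(X_A)$ is $\ker A$. 3. Let $L\subseteq\mathbb Z[x]^n$ be a toric lattice. Then $L=(L^C)^C$, $\mathbb L(I^+(L))=L$, the $\sigma$-variety $\mathbb V(I^+(L))$ is toric, and $\mathbb I(\mathbb V(I^+(L)))=I^+(L)$. There is a matrix $A\in\mathbb Z[x]^{m\times n}$, for some $m$, whose rows generate $L^C$; and for every such $A$, $I_A=I^+(L)$ and $X_A=\mathbb V(I^+(L))$. -/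

import Mathlib

open scoped Polynomial

universe u

noncomputable section

namespace DiffToric

/-! ### Difference field extensions of `ℚ` and difference polynomials -/

/-- A difference field extension of `ℚ` (on which the transforming operator is the identity):
a field `E` containing `ℚ` with an endomorphism `σ`, automatically injective and not required to
be surjective. -/
structure DiffField : Type (u + 1) where
  carrier : Type u
  [field : Field carrier]
  [algebra : Algebra ℚ carrier]
  σ : carrier →ₐ[ℚ] carrier

instance : CoeSort DiffField.{u} (Type u) := ⟨DiffField.carrier⟩

attribute [instance] DiffField.field DiffField.algebra

/-- `a ^ p = ∏ₖ (σᵏ a) ^ cₖ` for `p = ∑ₖ cₖ xᵏ ∈ ℤ[x]`. -/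
def DiffField.dpow (E : DiffField.{u}) (a : E) (p : ℤ[X]) : E :=
  ∏ k ∈ p.support, (E.σ^[k] a) ^ (p.coeff k)

/-- The difference polynomial ring `ℚ{y₁, …, yₙ}`; the variable `(i, k)` is `σᵏ yᵢ`. -/
abbrev DiffPoly (n : ℕ) : Type := MvPolynomial (Fin n × ℕ) ℚ

/-- The transforming operator of `ℚ{y₁, …, yₙ}`. -/
def DiffPoly.shift (n : ℕ) : DiffPoly n →ₐ[ℚ] DiffPoly n :=
  MvPolynomial.rename fun v => (v.1, v.2 + 1)

/-- The value `f(η)`, where `σᵏ yᵢ` is replaced by `σᵏ ηᵢ`. -/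
def DiffPoly.eval {n : ℕ} (E : DiffField.{u}) (η : Fin n → E) : DiffPoly n →ₐ[ℚ] E :=
  MvPolynomial.aeval fun v => E.σ^[v.2] (η v.1)

/-- The difference ideal `[S]` generated by `S`: the ideal generated by all transforms of
elements of `S`. -/
def diffIdealSpan {n : ℕ} (S : Set (DiffPoly n)) : Ideal (DiffPoly n) :=
  Ideal.span {f | ∃ k : ℕ, ∃ s ∈ S, f = (DiffPoly.shift n)^[k] s}

/-! ### Difference varieties -/

/-- An assignment, to each difference field extension `E` of `ℚ`, of a set of points of `Eⁿ`. -/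
abbrev PointFamily (n : ℕ) : Type (u + 1) := ∀ E : DiffField.{u}, Set (Fin n → E)

/-- The common zeros `E ↦ {η ∈ Eⁿ | p(η) = 0 for all p ∈ P}`. -/
def zeros {n : ℕ} (P : Set (DiffPoly n)) : PointFamily.{u} n :=
  fun E => {η | ∀ p ∈ P, DiffPoly.eval E η p = 0}

/-- A difference variety over `ℚ` in affine `n`-space: a functor of the form `E ↦ zeros P E`.
It is a subfunctor of `E ↦ Eⁿ`, so it is determined by its values on objects. -/
@[ext]
structure DiffVariety (n : ℕ) : Type (u + 1) where
  points : PointFamily.{u} n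
  exists_eq_zeros : ∃ P : Set (DiffPoly n), points = zeros P

/-- The difference variety `𝕍(P)` defined by a set `P` of difference polynomials. -/
def variety {n : ℕ} (P : Set (DiffPoly n)) : DiffVariety.{u} n := ⟨zeros P, P, rfl⟩

/-- The defining ideal `𝕀(V)`: the difference polynomials that vanish at all points of `V`. -/
def DiffVariety.definingIdeal {n : ℕ} (V : DiffVariety.{u} n) : Ideal (DiffPoly n) where
  carrier := {f | ∀ E : DiffField.{u}, ∀ η ∈ V.points E, DiffPoly.eval E η f = 0}
  zero_mem' := by intro E η _; simp
  add_mem' := by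
    intro f g hf hg E η hη
    simp [hf E η hη, hg E η hη]
  smul_mem' := by
    intro c f hf E η hη
    simp [hf E η hη]

/-- `V` is the Cohn closure of `T`: the smallest difference variety that contains `T`. -/
def IsCohnClosure {n : ℕ} (T : PointFamily.{u} n) (V : DiffVariety.{u} n) : Prop :=
  (∀ E, T E ⊆ V.points E) ∧
    ∀ W : DiffVariety.{u} n, (∀ E, T E ⊆ W.points E) → ∀ E, V.points E ⊆ W.points E

/-! ### Toric difference varieties -/

/-- The quasi difference torus of an `m × n` matrix `A` with columns `α₁, …, αₙ`: the image of
`(E*)ᵐ → (E*)ⁿ`, `t ↦ (t^α₁, …, t^αₙ)`. -/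
def quasiTorus {m n : ℕ} (A : Matrix (Fin m) (Fin n) ℤ[X]) : PointFamily.{u} n :=
  fun E => {η | ∃ t : Fin m → E, (∀ j, t j ≠ 0) ∧ ∀ i, η i = ∏ j, E.dpow (t j) (A j i)}

/-- The Laurent difference polynomial ring `ℚ{t₁^±, …, tₘ^±}`: the group algebra of `ℤ[x]ᵐ`. -/
abbrev LaurentDiffPoly (m : ℕ) : Type := AddMonoidAlgebra ℚ (Fin m → ℤ[X])

/-- The substitution `yᵢ ↦ T^αᵢ`, hence `σᵏ yᵢ ↦ T^(xᵏ αᵢ)`, where `αᵢ` is column `i` of `A`. -/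
def monomialSubst {m n : ℕ} (A : Matrix (Fin m) (Fin n) ℤ[X]) :
    DiffPoly n →ₐ[ℚ] LaurentDiffPoly m :=
  MvPolynomial.aeval fun v =>
    AddMonoidAlgebra.single (fun j => (Polynomial.X : ℤ[X]) ^ v.2 * A j v.1) (1 : ℚ)

/-- `I_A = {f | f(T^α₁, …, T^αₙ) = 0}`. -/
def implicitIdeal {m n : ℕ} (A : Matrix (Fin m) (Fin n) ℤ[X]) : Ideal (DiffPoly n) :=
  RingHom.ker (monomialSubst A)

/-- `X_A = 𝕍(I_A)`. -/
def toricVariety {m n : ℕ} (A : Matrix (Fin m) (Fin n) ℤ[X]) : DiffVariety.{u} n :=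
  variety (implicitIdeal A : Set (DiffPoly n))

/-- A difference variety is toric if it is the Cohn closure of a quasi difference torus. -/
def DiffVariety.IsToric {n : ℕ} (V : DiffVariety.{u} n) : Prop :=
  ∃ (m : ℕ) (A : Matrix (Fin m) (Fin n) ℤ[X]), IsCohnClosure (quasiTorus A) V

/-- A matrix with neither a zero row nor a zero column. -/
def NoZeroRowCol {m n : ℕ} (A : Matrix (Fin m) (Fin n) ℤ[X]) : Prop :=
  (∀ j, ∃ i, A j i ≠ 0) ∧ ∀ i, ∃ j, A j i ≠ 0

/-! ### Toric lattices and toric difference ideals -/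

/-- A `ℤ[x]`-lattice: a `ℤ[x]`-submodule of `ℤ[x]ⁿ`. -/
abbrev ZxLattice (n : ℕ) : Type := Submodule ℤ[X] (Fin n → ℤ[X])

/-- `ℤ[x]`-saturated (toric) lattices. -/
def IsToricLattice {n : ℕ} (L : ZxLattice n) : Prop :=
  ∀ (p : ℤ[X]) (f : Fin n → ℤ[X]), p ≠ 0 → p • f ∈ L → f ∈ L

/-- The positive part `p⁺ ∈ ℕ[x]` of `p ∈ ℤ[x]`, coefficient by coefficient. -/
def polyPosPart (p : ℤ[X]) : ℕ[X] :=
  ∑ k ∈ p.support, Polynomial.monomial k (p.coeff k).toNat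

/-- The negative part `p⁻ ∈ ℕ[x]` of `p ∈ ℤ[x]`, so that `p = p⁺ - p⁻`. -/
def polyNegPart (p : ℤ[X]) : ℕ[X] := polyPosPart (-p)

/-- The difference monomial `Y^a = ∏ᵢ ∏ₖ (σᵏ yᵢ) ^ aᵢₖ`, for `a ∈ ℕ[x]ⁿ` with
`aᵢ = ∑ₖ aᵢₖ xᵏ`. -/
def diffMonomial {n : ℕ} (a : Fin n → ℕ[X]) : DiffPoly n :=
  ∏ i, ∏ k ∈ (a i).support, (MvPolynomial.X (i, k) : DiffPoly n) ^ ((a i).coeff k)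

/-- The difference binomial `Y^(f⁺) - c Y^(f⁻)`. -/
def diffBinomial {n : ℕ} (f : Fin n → ℤ[X]) (c : ℚ) : DiffPoly n :=
  diffMonomial (fun i => polyPosPart (f i)) - c • diffMonomial (fun i => polyNegPart (f i))

/-- `I⁺(L) = [Y^(f⁺) - Y^(f⁻) | f ∈ L]`. -/
def latticeIdeal {n : ℕ} (L : ZxLattice n) : Ideal (DiffPoly n) :=
  diffIdealSpan {p | ∃ f ∈ L, p = diffBinomial f 1}

/-- A toric difference ideal is `I⁺(L)` for a toric lattice `L`. -/
def IsToricIdeal {n : ℕ} (I : Ideal (DiffPoly n)) : Prop :=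
  ∃ L : ZxLattice n, IsToricLattice L ∧ I = latticeIdeal L

/-- The support lattice of a (normal binomial) difference ideal `I`: all `f ∈ ℤ[x]ⁿ` such that
`Y^(f⁺) - c Y^(f⁻) ∈ I` for some `c ∈ ℚ*`. -/
def supportLattice {n : ℕ} (I : Ideal (DiffPoly n)) : Set (Fin n → ℤ[X]) :=
  {f | ∃ c : ℚ, c ≠ 0 ∧ diffBinomial f c ∈ I}

/-- The kernel `{f ∈ ℤ[x]ⁿ | A f = 0}`. -/
def kerLattice {m n : ℕ} (A : Matrix (Fin m) (Fin n) ℤ[X]) : ZxLattice n :=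
  LinearMap.ker A.mulVecLin

/-- The orthogonal complement `Lᶜ = {f | ⟨f, g⟩ = 0 for all g ∈ L}` for the dot product. -/
def orthComplement {n : ℕ} (L : ZxLattice n) : ZxLattice n where
  carrier := {f | ∀ g ∈ L, f ⬝ᵥ g = 0}
  zero_mem' := by intro g _; simp
  add_mem' := by
    intro a b ha hb g hg
    simp [add_dotProduct, ha g hg, hb g hg]
  smul_mem' := by
    intro c a ha g hg
    simp [smul_dotProduct, ha g hg]

/-- The rows of `A` generate `L`. -/
def RowsGenerate {m n : ℕ} (A : Matrix (Fin m) (Fin n) ℤ[X]) (L : ZxLattice n) : Prop :=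
  Submodule.span ℤ[X] (Set.range fun j : Fin m => (A j : Fin n → ℤ[X])) = L

end DiffToric

end

/-! Everything rests on one ring map: `monomialSubst A` sends the monomial with exponent vector `a`
to the Laurent monomial with exponent `A a`. Distinct Laurent monomials are linearly independent, so
its kernel is spanned by differences of monomials with equal image. Such a difference is a monomial
times `Y^(f⁺) - Y^(f⁻)` with `f ∈ ker A`, whence `I_A = I⁺(ker A)`
(`implicitIdeal_eq_latticeIdeal`).

The Laurent ring is a domain and multiplication of exponents by `x` is injective on it, so its
fraction field is a difference field. There the variables `tⱼ` give a torus point at which `f`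
vanishes exactly when `f ∈ I_A` (`mem_implicitIdeal_iff_eval_genericPoint`). This single point
determines the Cohn closure `X_A` and its ideal.

Finally, toric lattices are exactly the kernels of matrices. Over the fraction field of `ℤ[x]`, a
vector outside a saturated `L` is separated from `L` by a linear functional; clearing denominators
puts it in `Lᶜ`. So `L = (Lᶜ)ᶜ`, the kernel of any matrix whose rows generate `Lᶜ`. -/

namespace DiffToric

/-! ### Exponent vectors of difference monomials -/

/-- The vector in `ℤ[x]ⁿ` whose entry `i` is `∑ₖ a(i, k) xᵏ`. -/
noncomputable def polyVec (n : ℕ) : (Fin n × ℕ →₀ ℕ) →+ (Fin n → ℤ[X]) :=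
  Finsupp.liftAddHom fun v =>
    (AddMonoidHom.mk' (fun c : ℤ => (Pi.single v.1 (Polynomial.monomial v.2 c) : Fin n → ℤ[X]))
      (fun a b => by rw [map_add, Pi.single_add])).comp (Nat.castAddMonoidHom ℤ)

theorem polyVec_single {n : ℕ} (v : Fin n × ℕ) (c : ℕ) :
    polyVec n (Finsupp.single v c) = Pi.single v.1 (Polynomial.monomial v.2 (c : ℤ)) := by
  simp [polyVec]

theorem coeff_polyVec {n : ℕ} (a : Fin n × ℕ →₀ ℕ) (i : Fin n) (k : ℕ) :
    (polyVec n a i).coeff k = a (i, k) := by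
  induction a using Finsupp.induction_linear with
  | zero => simp
  | add a b ha hb => simp [ha, hb]
  | single v c =>
    rw [polyVec_single, Finsupp.single_apply]
    obtain ⟨j, l⟩ := v
    by_cases hj : j = i
    · subst hj
      simp [Polynomial.coeff_monomial]
    · simp [hj]

theorem coeff_polyPosPart (p : ℤ[X]) (k : ℕ) : (polyPosPart p).coeff k = (p.coeff k).toNat := by
  simp only [polyPosPart, Polynomial.finsetSum_coeff, Polynomial.coeff_monomial]
  rw [Finset.sum_ite_eq']
  split_ifs with h
  · rfl
  · simp [Polynomial.notMem_support_iff.1 h]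

theorem coeff_polyNegPart (p : ℤ[X]) (k : ℕ) : (polyNegPart p).coeff k = (-p.coeff k).toNat := by
  rw [polyNegPart, coeff_polyPosPart, Polynomial.coeff_neg]

/-- The exponent of the difference monomial `Y^a`. -/
noncomputable def monomialExponent {n : ℕ} (a : Fin n → ℕ[X]) : Fin n × ℕ →₀ ℕ :=
  ∑ i, ∑ k ∈ (a i).support, Finsupp.single (i, k) ((a i).coeff k)

theorem monomialExponent_apply {n : ℕ} (a : Fin n → ℕ[X]) (i : Fin n) (k : ℕ) :
    monomialExponent a (i, k) = (a i).coeff k := by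
  simp only [monomialExponent, Finsupp.finsetSum_apply, Finsupp.single_apply, Prod.mk.injEq]
  rw [Finset.sum_eq_single i]
  · simp only [true_and, Finset.sum_ite_eq']
    split_ifs with h
    · rfl
    · exact (Polynomial.notMem_support_iff.1 h).symm
  · intro j _ hj
    simp [hj]
  · simp

theorem diffMonomial_eq_monomial {n : ℕ} (a : Fin n → ℕ[X]) :
    diffMonomial a = MvPolynomial.monomial (monomialExponent a) 1 := by
  simp only [diffMonomial, monomialExponent, MvPolynomial.monomial_sum_one,
    MvPolynomial.X_pow_eq_monomial]

theorem polyVec_posPart_sub_negPart {n : ℕ} (f : Fin n → ℤ[X]) :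
    polyVec n (monomialExponent fun i => polyPosPart (f i)) -
      polyVec n (monomialExponent fun i => polyNegPart (f i)) = f := by
  funext i
  ext k
  simp only [Pi.sub_apply, Polynomial.coeff_sub, coeff_polyVec, monomialExponent_apply,
    coeff_polyPosPart, coeff_polyNegPart]
  omega

/-- Two exponents are the positive and the negative part of their difference, up to a common
summand. -/
theorem exists_eq_add_monomialExponent {n : ℕ} (a b : Fin n × ℕ →₀ ℕ) :
    ∃ c, a = c + monomialExponent (fun i => polyPosPart ((polyVec n a - polyVec n b) i)) ∧
      b = c + monomialExponent (fun i => polyNegPart ((polyVec n a - polyVec n b) i)) := by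
  -- The common summand is the entrywise minimum: `a - min(a, b)` is the positive part of `a - b`.
  refine ⟨a ⊓ b, ?_, ?_⟩ <;>
  · ext ⟨i, k⟩
    simp only [Finsupp.add_apply, monomialExponent_apply, coeff_polyPosPart, coeff_polyNegPart,
      Pi.sub_apply, Polynomial.coeff_sub, coeff_polyVec, Finsupp.inf_apply]
    omega

/-! ### The kernel of the monomial substitution -/

theorem monomialSubst_monomial {m n : ℕ} (A : Matrix (Fin m) (Fin n) ℤ[X])
    (a : Fin n × ℕ →₀ ℕ) (r : ℚ) :
    monomialSubst A (MvPolynomial.monomial a r) =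
      AddMonoidAlgebra.single (A.mulVec (polyVec n a)) r := by
  have key : (a.prod fun v c => (AddMonoidAlgebra.single
      (fun j => (Polynomial.X : ℤ[X]) ^ v.2 * A j v.1) (1 : ℚ) : LaurentDiffPoly m) ^ c) =
      AddMonoidAlgebra.single (A.mulVec (polyVec n a)) 1 := by
    induction a using Finsupp.induction_linear with
    | zero => simp [AddMonoidAlgebra.one_def]
    | add a b ha hb =>
      rw [Finsupp.prod_add_index' (by simp) (by intros; rw [pow_add]), ha, hb,
        AddMonoidAlgebra.single_mul_single, map_add, Matrix.mulVec_add, one_mul]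
    | single v c =>
      rw [Finsupp.prod_single_index (by simp), AddMonoidAlgebra.single_pow, one_pow, polyVec_single]
      congr 1
      funext j
      rw [Matrix.mulVec_single]
      simp only [Pi.smul_apply, nsmul_eq_mul, Matrix.col_apply, MulOpposite.smul_eq_mul_unop,
        MulOpposite.unop_op, ← Polynomial.C_mul_X_pow_eq_monomial]
      simp only [map_natCast]
      ring
  rw [monomialSubst, MvPolynomial.aeval_monomial, key]
  simp

theorem monomialSubst_diffBinomial {m n : ℕ} (A : Matrix (Fin m) (Fin n) ℤ[X])
    (f : Fin n → ℤ[X]) (c : ℚ) :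
    monomialSubst A (diffBinomial f c) =
      AddMonoidAlgebra.single
        (A.mulVec (polyVec n (monomialExponent fun i => polyPosPart (f i)))) 1 -
      AddMonoidAlgebra.single
        (A.mulVec (polyVec n (monomialExponent fun i => polyNegPart (f i)))) c := by
  simp [diffBinomial, diffMonomial_eq_monomial, monomialSubst_monomial]

theorem mulVec_posPart_eq_negPart_iff {m n : ℕ} (A : Matrix (Fin m) (Fin n) ℤ[X])
    (f : Fin n → ℤ[X]) :
    A.mulVec (polyVec n (monomialExponent fun i => polyPosPart (f i))) =
      A.mulVec (polyVec n (monomialExponent fun i => polyNegPart (f i))) ↔ f ∈ kerLattice A := by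
  rw [← sub_eq_zero, ← Matrix.mulVec_sub, polyVec_posPart_sub_negPart]
  rfl

theorem diffBinomial_one_mem_implicitIdeal {m n : ℕ} {A : Matrix (Fin m) (Fin n) ℤ[X]}
    {f : Fin n → ℤ[X]} (hf : f ∈ kerLattice A) : diffBinomial f 1 ∈ implicitIdeal A := by
  rw [implicitIdeal, RingHom.mem_ker, monomialSubst_diffBinomial,
    (mulVec_posPart_eq_negPart_iff A f).2 hf, sub_self]

theorem mem_kerLattice_of_diffBinomial_mem {m n : ℕ} {A : Matrix (Fin m) (Fin n) ℤ[X]}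
    {f : Fin n → ℤ[X]} {c : ℚ} (hf : diffBinomial f c ∈ implicitIdeal A) :
    f ∈ kerLattice A := by
  rw [implicitIdeal, RingHom.mem_ker, monomialSubst_diffBinomial, sub_eq_zero] at hf
  rw [← mulVec_posPart_eq_negPart_iff]
  -- Compare coefficients at the image of `Y^(f⁺)`: 1 on the left, but 0 on the right if the two
  -- exponents differ.
  have h := congrArg (fun g => AddMonoidAlgebra.coeff g
    (A.mulVec (polyVec n (monomialExponent fun i => polyPosPart (f i))))) hf
  by_contra hne
  simp [Ne.symm hne] at h

theorem supportLattice_implicitIdeal {m n : ℕ} (A : Matrix (Fin m) (Fin n) ℤ[X]) :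
    supportLattice (implicitIdeal A) = (kerLattice A : Set (Fin n → ℤ[X])) := by
  ext f
  exact ⟨fun ⟨_, _, h⟩ => mem_kerLattice_of_diffBinomial_mem h,
    fun h => ⟨1, one_ne_zero, diffBinomial_one_mem_implicitIdeal h⟩⟩

/-- Multiplication by `x` on exponents, as an endomorphism of the Laurent difference polynomial
ring. -/
noncomputable def laurentShift (m : ℕ) : LaurentDiffPoly m →ₐ[ℚ] LaurentDiffPoly m :=
  AddMonoidAlgebra.mapDomainAlgHom ℚ ℚ
    (DistribSMul.toAddMonoidHom (Fin m → ℤ[X]) (Polynomial.X : ℤ[X]))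

theorem laurentShift_single {m : ℕ} (g : Fin m → ℤ[X]) (r : ℚ) :
    laurentShift m (AddMonoidAlgebra.single g r) =
      AddMonoidAlgebra.single ((Polynomial.X : ℤ[X]) • g) r := by
  simp [laurentShift]

theorem laurentShift_injective (m : ℕ) : Function.Injective (laurentShift m) :=
  AddMonoidAlgebra.mapDomain_injective fun g h hgh => by
    funext j
    exact mul_left_cancel₀ Polynomial.X_ne_zero (congrFun hgh j)

/-- Multiplying the exponent of each `yᵢ` by `x` commutes with the matrix `A`; hence the kernel is
stable under the shift. -/
theorem monomialSubst_shift {m n : ℕ} (A : Matrix (Fin m) (Fin n) ℤ[X]) (f : DiffPoly n) :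
    monomialSubst A (DiffPoly.shift n f) = laurentShift m (monomialSubst A f) := by
  refine DFunLike.congr_fun (f := (monomialSubst A).comp (DiffPoly.shift n))
    (g := (laurentShift m).comp (monomialSubst A)) (MvPolynomial.algHom_ext fun v => ?_) f
  simp only [AlgHom.comp_apply, DiffPoly.shift, MvPolynomial.rename_X, monomialSubst,
    MvPolynomial.aeval_X, laurentShift_single]
  congr 1
  funext j
  simp [pow_succ']
  ring

theorem latticeIdeal_le_implicitIdeal {m n : ℕ} (A : Matrix (Fin m) (Fin n) ℤ[X]) :
    latticeIdeal (kerLattice A) ≤ implicitIdeal A := by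
  refine Ideal.span_le.2 ?_
  rintro _ ⟨k, _, ⟨f, hf, rfl⟩, rfl⟩
  induction k with
  | zero => exact diffBinomial_one_mem_implicitIdeal hf
  | succ k ih =>
    have ih' : monomialSubst A ((DiffPoly.shift n)^[k] (diffBinomial f 1)) = 0 := ih
    change monomialSubst A _ = 0
    rw [Function.iterate_succ_apply', monomialSubst_shift, ih', map_zero]

theorem monomial_sub_monomial_mem_latticeIdeal {n : ℕ} {L : ZxLattice n}
    {a b : Fin n × ℕ →₀ ℕ} (h : polyVec n a - polyVec n b ∈ L) (r : ℚ) :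
    MvPolynomial.monomial a r - MvPolynomial.monomial b r ∈ latticeIdeal L := by
  obtain ⟨c, ha, hb⟩ := exists_eq_add_monomialExponent a b
  have hmem : diffBinomial (polyVec n a - polyVec n b) 1 ∈ latticeIdeal L :=
    Ideal.subset_span ⟨0, _, ⟨_, h, rfl⟩, rfl⟩
  have heq : (MvPolynomial.monomial a r - MvPolynomial.monomial b r : DiffPoly n) =
      MvPolynomial.monomial c r * diffBinomial (polyVec n a - polyVec n b) 1 := by
    rw [diffBinomial, diffMonomial_eq_monomial, diffMonomial_eq_monomial, one_smul, mul_sub,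
      MvPolynomial.monomial_mul, MvPolynomial.monomial_mul, mul_one, ← ha, ← hb]
  rw [heq]
  exact Ideal.mul_mem_left _ _ hmem

/-- An exponent with a given image in `ℤ[x]ᵐ`, if there is one. -/
noncomputable def exponentLift {m n : ℕ} (A : Matrix (Fin m) (Fin n) ℤ[X]) (g : Fin m → ℤ[X]) :
    Fin n × ℕ →₀ ℕ :=
  -- Off the image the value is arbitrary; only values on the image matter below.
  Function.invFun (fun a => A.mulVec (polyVec n a)) g

theorem mulVec_polyVec_exponentLift {m n : ℕ} (A : Matrix (Fin m) (Fin n) ℤ[X])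
    (a : Fin n × ℕ →₀ ℕ) :
    A.mulVec (polyVec n (exponentLift A (A.mulVec (polyVec n a)))) = A.mulVec (polyVec n a) :=
  Function.invFun_eq (f := fun a => A.mulVec (polyVec n a)) ⟨a, rfl⟩

/-- The additive map that sends a Laurent monomial in the image of the substitution to a
difference monomial in its preimage. -/
noncomputable def monomialLift {m n : ℕ} (A : Matrix (Fin m) (Fin n) ℤ[X]) :
    LaurentDiffPoly m →+ DiffPoly n :=
  (Finsupp.liftAddHom fun g =>
    (MvPolynomial.monomial (exponentLift A g) : ℚ →ₗ[ℚ] DiffPoly n).toAddMonoidHom).comp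
      (AddMonoidAlgebra.coeffAddEquiv).toAddMonoidHom

theorem monomialLift_single {m n : ℕ} (A : Matrix (Fin m) (Fin n) ℤ[X]) (g : Fin m → ℤ[X])
    (r : ℚ) : monomialLift A (AddMonoidAlgebra.single g r) =
      MvPolynomial.monomial (exponentLift A g) r := by
  simp [monomialLift]

/-- A normal form: modulo `I⁺(ker A)` each monomial equals the chosen representative of its fibre.
For `f ∈ I_A` the normal form is the lift of 0, so `f` itself lies in the lattice ideal. -/
theorem sub_monomialLift_mem_latticeIdeal {m n : ℕ} (A : Matrix (Fin m) (Fin n) ℤ[X])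
    (f : DiffPoly n) : f - monomialLift A (monomialSubst A f) ∈ latticeIdeal (kerLattice A) := by
  induction f using MvPolynomial.induction_on' with
  | monomial a r =>
    rw [monomialSubst_monomial, monomialLift_single]
    refine monomial_sub_monomial_mem_latticeIdeal ?_ r
    change A.mulVec _ = 0
    rw [Matrix.mulVec_sub, mulVec_polyVec_exponentLift, sub_self]
  | add f g hf hg =>
    rw [map_add, map_add, add_sub_add_comm]
    exact add_mem hf hg

theorem implicitIdeal_eq_latticeIdeal {m n : ℕ} (A : Matrix (Fin m) (Fin n) ℤ[X]) :
    implicitIdeal A = latticeIdeal (kerLattice A) := by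
  refine le_antisymm (fun f hf => ?_) (latticeIdeal_le_implicitIdeal A)
  have h := sub_monomialLift_mem_latticeIdeal A f
  rwa [show monomialSubst A f = 0 from hf, map_zero, sub_zero] at h

/-! ### Toric lattices and orthogonal complements -/

theorem isToricLattice_kerLattice {m n : ℕ} (A : Matrix (Fin m) (Fin n) ℤ[X]) :
    IsToricLattice (kerLattice A) := by
  intro p f hp hpf
  change A.mulVec (p • f) = 0 at hpf
  rw [Matrix.mulVec_smul] at hpf
  exact (smul_eq_zero.1 hpf).resolve_left hp

/-- Vectors that some nonzero polynomial multiplies into `L` form a subspace over the fraction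
field, by taking products of denominators. -/
theorem exists_smul_mem_of_map_mem_span {n : ℕ} (L : ZxLattice n) {f : Fin n → ℤ[X]}
    (hf : (fun i => algebraMap ℤ[X] (FractionRing ℤ[X]) (f i)) ∈
      Submodule.span (FractionRing ℤ[X])
        ((fun g : Fin n → ℤ[X] => fun i => algebraMap ℤ[X] (FractionRing ℤ[X]) (g i)) '' L)) :
    ∃ p : ℤ[X], p ≠ 0 ∧ p • f ∈ L := by
  have key : ∀ w ∈ Submodule.span (FractionRing ℤ[X])
      ((fun g : Fin n → ℤ[X] => fun i => algebraMap ℤ[X] (FractionRing ℤ[X]) (g i)) '' L),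
      ∃ p : ℤ[X], p ≠ 0 ∧ ∃ l ∈ L, algebraMap ℤ[X] (FractionRing ℤ[X]) p • w =
        fun i => algebraMap ℤ[X] (FractionRing ℤ[X]) (l i) := by
    intro w hw
    induction hw using Submodule.span_induction with
    | mem w hw =>
      obtain ⟨l, hl, rfl⟩ := hw
      exact ⟨1, one_ne_zero, l, hl, by simp⟩
    | zero => exact ⟨1, one_ne_zero, 0, zero_mem _, by ext; simp⟩
    | add v w _ _ hv hw =>
      obtain ⟨p, hp, l, hl, hpl⟩ := hv
      obtain ⟨q, hq, l', hl', hql⟩ := hw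
      refine ⟨p * q, mul_ne_zero hp hq, q • l + p • l',
        add_mem (L.smul_mem _ hl) (L.smul_mem _ hl'), ?_⟩
      funext i
      have h1 := congrFun hpl i
      have h2 := congrFun hql i
      simp only [Pi.smul_apply, Pi.add_apply, smul_eq_mul, map_add, map_mul] at h1 h2 ⊢
      rw [← h1, ← h2]
      ring
    | smul c w _ hw =>
      obtain ⟨p, hp, l, hl, hpl⟩ := hw
      obtain ⟨a, b, hb, rfl⟩ := IsFractionRing.div_surjective (A := ℤ[X]) c
      have hb0 : b ≠ 0 := nonZeroDivisors.ne_zero hb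
      have hb' : algebraMap ℤ[X] (FractionRing ℤ[X]) b ≠ 0 := by simpa using hb0
      refine ⟨b * p, mul_ne_zero hb0 hp, a • l, L.smul_mem _ hl, ?_⟩
      funext i
      have h1 := congrFun hpl i
      simp only [Pi.smul_apply, smul_eq_mul, map_mul] at h1 ⊢
      rw [← h1]
      field_simp
  obtain ⟨p, hp, l, hl, hpl⟩ := key _ hf
  refine ⟨p, hp, ?_⟩
  convert hl
  funext i
  refine IsFractionRing.injective ℤ[X] (FractionRing ℤ[X]) ?_
  simpa using congrFun hpl i

theorem exists_mem_orthComplement_dotProduct_ne_zero {n : ℕ} {L : ZxLattice n}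
    (hL : IsToricLattice L) {f : Fin n → ℤ[X]} (hf : f ∉ L) :
    ∃ g ∈ orthComplement L, f ⬝ᵥ g ≠ 0 := by
  obtain ⟨φ, hφ, hker⟩ := Submodule.exists_le_ker_of_notMem fun h =>
    have ⟨p, hp, hpf⟩ := exists_smul_mem_of_map_mem_span L (f := f) h
    hf (hL p f hp hpf)
  -- A common denominator `b` of the values of `φ` on the standard basis makes `b φ` the dot product
  -- with a polynomial vector `g`.
  obtain ⟨b, hb⟩ := IsLocalization.exist_integer_multiples_of_finite (nonZeroDivisors ℤ[X])
    fun i : Fin n => φ (Pi.single i 1)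
  choose g hg using hb
  have hb0 : algebraMap ℤ[X] (FractionRing ℤ[X]) b ≠ 0 := by simp
  have hdot : ∀ v : Fin n → ℤ[X], algebraMap ℤ[X] (FractionRing ℤ[X]) (v ⬝ᵥ g) =
      algebraMap ℤ[X] (FractionRing ℤ[X]) b *
        φ fun i => algebraMap ℤ[X] (FractionRing ℤ[X]) (v i) := by
    intro v
    rw [LinearMap.pi_apply_eq_sum_univ φ, dotProduct, map_sum, Finset.mul_sum]
    refine Finset.sum_congr rfl fun i _ => ?_
    have h1 := hg i
    have h2 : (fun j => if i = j then (1 : FractionRing ℤ[X]) else 0) = Pi.single i 1 := by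
      funext j
      simp [Pi.single_apply, eq_comm]
    rw [map_mul, h1, h2, Algebra.smul_def, smul_eq_mul]
    ring
  refine ⟨g, fun l hl => ?_, fun h => ?_⟩
  · rw [dotProduct_comm]
    refine IsFractionRing.injective ℤ[X] (FractionRing ℤ[X]) ?_
    have h0 : φ (fun i => algebraMap ℤ[X] (FractionRing ℤ[X]) (l i)) = 0 :=
      hker (Submodule.subset_span ⟨l, hl, rfl⟩)
    rw [hdot, h0, mul_zero, map_zero]
  · have := hdot f
    rw [h, map_zero] at this
    exact mul_ne_zero hb0 hφ this.symm

theorem orthComplement_orthComplement {n : ℕ} {L : ZxLattice n} (hL : IsToricLattice L) :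
    orthComplement (orthComplement L) = L := by
  refine le_antisymm (fun f hf => ?_) fun f hf g hg => ?_
  · by_contra hfL
    obtain ⟨g, hg, hne⟩ := exists_mem_orthComplement_dotProduct_ne_zero hL hfL
    exact hne (hf g hg)
  · rw [dotProduct_comm]
    exact hg f hf

theorem kerLattice_eq_orthComplement {m n : ℕ} {A : Matrix (Fin m) (Fin n) ℤ[X]}
    {M : ZxLattice n} (hA : RowsGenerate A M) : kerLattice A = orthComplement M := by
  ext f
  refine ⟨fun hf g hg => ?_, fun hf => ?_⟩
  · rw [← hA] at hg
    induction hg using Submodule.span_induction with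
    | mem g hg =>
      obtain ⟨j, rfl⟩ := hg
      rw [dotProduct_comm]
      exact congrFun hf j
    | zero => simp
    | add g h _ _ hg hh => rw [dotProduct_add, hg, hh, add_zero]
    | smul c g _ hg => rw [dotProduct_smul, hg, smul_zero]
  · funext j
    change A j ⬝ᵥ f = 0
    rw [dotProduct_comm]
    exact hf _ (hA ▸ Submodule.subset_span ⟨j, rfl⟩)

theorem exists_rowsGenerate {n : ℕ} (M : ZxLattice n) :
    ∃ (m : ℕ) (A : Matrix (Fin m) (Fin n) ℤ[X]), RowsGenerate A M ∧ ∀ j, ∃ i, A j i ≠ 0 := by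
  classical
  obtain ⟨S, hS⟩ := IsNoetherian.noetherian M
  -- Dropping 0 leaves the span unchanged and excludes zero rows, as the normalized form of the
  -- correspondence requires.
  let e := (S.erase 0).equivFin
  refine ⟨_, fun j => (e.symm j : Fin n → ℤ[X]), ?_, fun j => ?_⟩
  · have hr : (Set.range fun j => (e.symm j : Fin n → ℤ[X])) = (S : Set (Fin n → ℤ[X])) \ {0} := by
      ext v
      constructor
      · rintro ⟨j, rfl⟩
        have := (e.symm j).2
        simp only [Finset.mem_erase] at this
        exact ⟨this.2, this.1⟩
      · rintro ⟨h1, h2⟩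
        exact ⟨e ⟨v, Finset.mem_erase.2 ⟨h2, h1⟩⟩, by simp⟩
    change Submodule.span ℤ[X] (Set.range fun j => (e.symm j : Fin n → ℤ[X])) = M
    rw [hr, Submodule.span_sdiff_singleton_zero, hS]
  · exact Function.ne_iff.1 (Finset.ne_of_mem_erase (e.symm j).2)

theorem single_mem_kerLattice_iff {m n : ℕ} (A : Matrix (Fin m) (Fin n) ℤ[X]) (i : Fin n) :
    (Pi.single i 1 : Fin n → ℤ[X]) ∈ kerLattice A ↔ ∀ j, A j i = 0 := by
  change A.mulVec _ = 0 ↔ _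
  rw [Matrix.mulVec_single_one, funext_iff]
  rfl

/-! ### Powers with exponents in `ℤ[x]` -/

namespace DiffField

theorem iterate_ne_zero (E : DiffField.{u}) {a : E} (ha : a ≠ 0) (k : ℕ) : E.σ^[k] a ≠ 0 := by
  rw [← AlgHom.coe_pow]
  exact (map_ne_zero _).2 ha

theorem dpow_zero (E : DiffField.{u}) (a : E) : E.dpow a 0 = 1 := by
  simp [dpow]

theorem dpow_eq_prod (E : DiffField.{u}) (a : E) {p : ℤ[X]} {s : Finset ℕ} (hs : p.support ⊆ s) :
    E.dpow a p = ∏ k ∈ s, (E.σ^[k] a) ^ (p.coeff k) :=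
  Finset.prod_subset hs fun k _ hk => by
    rw [Polynomial.notMem_support_iff.1 hk, zpow_zero]

theorem dpow_monomial (E : DiffField.{u}) (a : E) (k : ℕ) (c : ℤ) :
    E.dpow a (Polynomial.monomial k c) = (E.σ^[k] a) ^ c := by
  rw [E.dpow_eq_prod a (Polynomial.support_monomial_subset k c), Finset.prod_singleton,
    Polynomial.coeff_monomial_same]

theorem dpow_add (E : DiffField.{u}) {a : E} (ha : a ≠ 0) (p q : ℤ[X]) :
    E.dpow a (p + q) = E.dpow a p * E.dpow a q := by
  rw [E.dpow_eq_prod a (Polynomial.support_add (p := p) (q := q)),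
    E.dpow_eq_prod a (p := p) Finset.subset_union_left,
    E.dpow_eq_prod a (p := q) Finset.subset_union_right, ← Finset.prod_mul_distrib]
  exact Finset.prod_congr rfl fun k _ => by
    rw [Polynomial.coeff_add, zpow_add₀ (E.iterate_ne_zero ha k)]

theorem iterate_dpow (E : DiffField.{u}) {a : E} (ha : a ≠ 0) (k : ℕ) (p : ℤ[X]) :
    E.σ^[k] (E.dpow a p) = E.dpow a (Polynomial.X ^ k * p) := by
  induction p using Polynomial.induction_on' with
  | add p q hp hq =>
    rw [E.dpow_add ha, mul_add, E.dpow_add ha, ← hp, ← hq, ← AlgHom.coe_pow, map_mul]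
  | monomial l c =>
    rw [Polynomial.X_pow_mul_monomial, E.dpow_monomial, E.dpow_monomial, ← AlgHom.coe_pow,
      map_zpow₀, AlgHom.coe_pow, ← Function.iterate_add_apply, add_comm]

/-- The character `g ↦ ∏ⱼ tⱼ ^ gⱼ` of `ℤ[x]ᵐ`. -/
noncomputable def character (E : DiffField.{u}) {m : ℕ} (t : Fin m → E) (ht : ∀ j, t j ≠ 0) :
    Multiplicative (Fin m → ℤ[X]) →* E where
  toFun g := ∏ j, E.dpow (t j) (g.toAdd j)
  map_one' := by simp [dpow_zero]
  map_mul' g h := by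
    rw [← Finset.prod_mul_distrib]
    exact Finset.prod_congr rfl fun j _ => E.dpow_add (ht j) _ _

/-- The value of a Laurent difference polynomial at a point of `(E*)ᵐ`. -/
noncomputable def laurentEval (E : DiffField.{u}) {m : ℕ} (t : Fin m → E) (ht : ∀ j, t j ≠ 0) :
    LaurentDiffPoly m →ₐ[ℚ] E :=
  AddMonoidAlgebra.lift ℚ E _ (E.character t ht)

theorem laurentEval_single (E : DiffField.{u}) {m : ℕ} (t : Fin m → E) (ht : ∀ j, t j ≠ 0)
    (g : Fin m → ℤ[X]) :
    E.laurentEval t ht (AddMonoidAlgebra.single g 1) = ∏ j, E.dpow (t j) (g j) := by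
  rw [laurentEval, AddMonoidAlgebra.lift_single, one_smul]
  rfl

end DiffField

/-- Evaluation at a torus point factors through the substitution, because `σᵏ(t^p) = t^(xᵏ p)`.
Elements of `I_A` therefore vanish on the whole torus. -/
theorem eval_eq_laurentEval {m n : ℕ} (A : Matrix (Fin m) (Fin n) ℤ[X]) (E : DiffField.{u})
    (t : Fin m → E) (ht : ∀ j, t j ≠ 0) (f : DiffPoly n) :
    DiffPoly.eval E (fun i => ∏ j, E.dpow (t j) (A j i)) f =
      E.laurentEval t ht (monomialSubst A f) := by
  refine DFunLike.congr_fun (f := DiffPoly.eval E fun i => ∏ j, E.dpow (t j) (A j i))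
    (g := (E.laurentEval t ht).comp (monomialSubst A)) (MvPolynomial.algHom_ext fun v => ?_) f
  rw [AlgHom.comp_apply, DiffPoly.eval, MvPolynomial.aeval_X, monomialSubst,
    MvPolynomial.aeval_X, DiffField.laurentEval_single, ← AlgHom.coe_pow, map_prod]
  exact Finset.prod_congr rfl fun j _ => by
    rw [AlgHom.coe_pow, E.iterate_dpow (ht j)]

/-! ### The generic point of a quasi difference torus -/

/-- Unique sums of exponents rule out zero divisors in the Laurent ring, so it has a field of
fractions. -/
instance twoUniqueSums_exponents (m : ℕ) : TwoUniqueSums (Fin m → ℤ[X]) :=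
  TwoUniqueSums.of_injective_addHom
    (H := Fin m → ℤ[X]) (G := Fin m × ℕ → ℤ)
    ⟨fun g v => (g v.1).coeff v.2, fun g h => by ext; simp⟩
    (fun g h hgh => by
      funext j
      ext k
      exact congrFun hgh (j, k)) inferInstance

/-- The field of fractions of the Laurent difference polynomial ring, as a difference field. -/
noncomputable def genericField (m : ℕ) : DiffField.{u} where
  -- The lift moves the field into the universe over which points are quantified.
  carrier := ULift.{u} (FractionRing (LaurentDiffPoly m))
  σ := (((ULift.ringEquiv (R := FractionRing (LaurentDiffPoly m))).symm.toRingHom.comp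
    (IsFractionRing.map (K := FractionRing (LaurentDiffPoly m))
      (L := FractionRing (LaurentDiffPoly m))
      (j := (laurentShift m).toRingHom) (laurentShift_injective m))).comp
        (ULift.ringEquiv (R := FractionRing (LaurentDiffPoly m))).toRingHom).toRatAlgHom

/-- The embedding of the Laurent difference polynomial ring into its field of fractions. -/
noncomputable def toGenericField (m : ℕ) : LaurentDiffPoly m →ₐ[ℚ] genericField.{u} m :=
  ((ULift.ringEquiv (R := FractionRing (LaurentDiffPoly m))).symm.toRingHom.comp
    (algebraMap (LaurentDiffPoly m) (FractionRing (LaurentDiffPoly m)))).toRatAlgHom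

theorem toGenericField_injective (m : ℕ) : Function.Injective (toGenericField.{u} m) :=
  ULift.up_injective.comp (IsFractionRing.injective _ _)

theorem σ_toGenericField {m : ℕ} (x : LaurentDiffPoly m) :
    (genericField.{u} m).σ (toGenericField m x) = toGenericField m (laurentShift m x) := by
  exact congrArg ULift.up (IsLocalization.map_eq _ x)

theorem iterate_σ_toGenericField {m : ℕ} (k : ℕ) (g : Fin m → ℤ[X]) :
    (genericField.{u} m).σ^[k] (toGenericField m (AddMonoidAlgebra.single g 1)) =
      toGenericField m (AddMonoidAlgebra.single ((Polynomial.X : ℤ[X]) ^ k • g) 1) := by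
  induction k with
  | zero => simp
  | succ k ih =>
    rw [Function.iterate_succ_apply', ih, σ_toGenericField, laurentShift_single, smul_smul,
      pow_succ']

/-- The coordinates of the generic point of the torus. -/
noncomputable def genericPoint (m : ℕ) (j : Fin m) : genericField.{u} m :=
  toGenericField m (AddMonoidAlgebra.single (Pi.single j 1) 1)

theorem genericPoint_ne_zero {m : ℕ} (j : Fin m) : genericPoint.{u} m j ≠ 0 :=
  (map_ne_zero_iff _ (toGenericField_injective m)).2 (by simp)

theorem dpow_genericPoint {m : ℕ} (j : Fin m) (p : ℤ[X]) :
    (genericField.{u} m).dpow (genericPoint m j) p =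
      toGenericField m (AddMonoidAlgebra.single (Pi.single j p) 1) := by
  induction p using Polynomial.induction_on' with
  | add p q hp hq =>
    rw [DiffField.dpow_add _ (genericPoint_ne_zero j), hp, hq, ← map_mul,
      AddMonoidAlgebra.single_mul_single, one_mul, Pi.single_add]
  | monomial k c =>
    rw [DiffField.dpow_monomial, genericPoint, iterate_σ_toGenericField]
    -- Laurent monomials form a group, so negative powers `c` are carried across as well.
    have h := map_zpow ((toGenericField.{u} m).toMonoidHom.comp (AddMonoidAlgebra.of ℚ _))
      (Multiplicative.ofAdd ((Polynomial.X : ℤ[X]) ^ k • (Pi.single j 1 : Fin m → ℤ[X]))) c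
    refine h.symm.trans (congrArg (fun g => toGenericField m (AddMonoidAlgebra.single g 1)) ?_)
    change c • ((Polynomial.X : ℤ[X]) ^ k • (Pi.single j 1 : Fin m → ℤ[X])) = _
    rw [← Pi.single_smul', ← Pi.single_smul', smul_eq_mul, mul_one,
      ← Polynomial.C_mul_X_pow_eq_monomial, zsmul_eq_mul]
    simp

theorem laurentEval_genericPoint {m : ℕ} (f : LaurentDiffPoly m) :
    (genericField.{u} m).laurentEval (genericPoint m) genericPoint_ne_zero f =
      toGenericField m f := by
  refine DFunLike.congr_fun (AddMonoidAlgebra.algHom_ext (fun g => ?_)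
    (Subsingleton.elim _ _)) f
  rw [DiffField.laurentEval_single]
  simp only [dpow_genericPoint]
  rw [← map_prod]
  congr 1
  have h := map_prod (AddMonoidAlgebra.of ℚ (Fin m → ℤ[X]))
    (fun j => Multiplicative.ofAdd (Pi.single j (g j) : Fin m → ℤ[X])) Finset.univ
  refine h.symm.trans (congrArg (fun g => AddMonoidAlgebra.single g (1 : ℚ)) ?_)
  change ∑ j, Pi.single j (g j) = g
  exact Finset.univ_sum_single g

theorem mem_implicitIdeal_iff_eval_genericPoint {m n : ℕ} (A : Matrix (Fin m) (Fin n) ℤ[X])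
    (f : DiffPoly n) : f ∈ implicitIdeal A ↔
      DiffPoly.eval (genericField.{u} m)
        (fun i => ∏ j, (genericField.{u} m).dpow (genericPoint m j) (A j i)) f = 0 := by
  rw [eval_eq_laurentEval A _ _ genericPoint_ne_zero, laurentEval_genericPoint,
    map_eq_zero_iff _ (toGenericField_injective m)]
  rfl

/-! ### Toric difference varieties -/

theorem quasiTorus_subset_toricVariety {m n : ℕ} (A : Matrix (Fin m) (Fin n) ℤ[X])
    (E : DiffField.{u}) : quasiTorus A E ⊆ (toricVariety A).points E := by
  rintro η ⟨t, ht, hη⟩ f hf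
  rw [funext hη, eval_eq_laurentEval A E t ht, show monomialSubst A f = 0 from hf, map_zero]

theorem genericPoint_mem_quasiTorus {m n : ℕ} (A : Matrix (Fin m) (Fin n) ℤ[X]) :
    (fun i => ∏ j, (genericField.{u} m).dpow (genericPoint m j) (A j i)) ∈
      quasiTorus A (genericField.{u} m) :=
  ⟨genericPoint m, genericPoint_ne_zero, fun _ => rfl⟩

/-- Minimality: the equations of any `W` containing the torus vanish at the generic point, hence lie
in `I_A`. -/
theorem isCohnClosure_toricVariety {m n : ℕ} (A : Matrix (Fin m) (Fin n) ℤ[X]) :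
    IsCohnClosure (quasiTorus A) (toricVariety.{u} A) := by
  refine ⟨quasiTorus_subset_toricVariety A, fun W hW E η hη => ?_⟩
  obtain ⟨P, hP⟩ := W.exists_eq_zeros
  rw [hP]
  intro p hp
  refine hη p ((mem_implicitIdeal_iff_eval_genericPoint.{u} A p).2 ?_)
  have h := hW _ (genericPoint_mem_quasiTorus A)
  rw [hP] at h
  exact h p hp

theorem definingIdeal_toricVariety {m n : ℕ} (A : Matrix (Fin m) (Fin n) ℤ[X]) :
    (toricVariety.{u} A).definingIdeal = implicitIdeal A := by
  refine le_antisymm (fun f hf => ?_) fun f hf E η hη => hη f hf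
  exact (mem_implicitIdeal_iff_eval_genericPoint.{u} A f).2
    (hf _ _ (quasiTorus_subset_toricVariety A _ (genericPoint_mem_quasiTorus A)))

theorem IsCohnClosure.eq {n : ℕ} {T : PointFamily.{u} n} {V W : DiffVariety.{u} n}
    (hV : IsCohnClosure T V) (hW : IsCohnClosure T W) : V = W := by
  ext E : 2
  exact Set.Subset.antisymm (hV.2 W hW.1 E) (hW.2 V hV.1 E)

/-- This lets a condition on the defining ideal determine the variety itself. -/
theorem variety_definingIdeal {n : ℕ} (V : DiffVariety.{u} n) :
    variety (V.definingIdeal : Set (DiffPoly n)) = V := by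
  ext E : 2
  refine Set.Subset.antisymm (fun η hη => ?_) fun η hη f hf => hf E η hη
  obtain ⟨P, hP⟩ := V.exists_eq_zeros
  rw [hP]
  refine fun p hp => hη p fun F θ hθ => ?_
  rw [hP] at hθ
  exact hθ p hp

theorem definingIdeal_eq_of_isCohnClosure {m n : ℕ} {A : Matrix (Fin m) (Fin n) ℤ[X]}
    {V : DiffVariety.{u} n} (hV : IsCohnClosure (quasiTorus A) V) :
    V.definingIdeal = latticeIdeal (kerLattice A) := by
  rw [hV.eq (isCohnClosure_toricVariety A), definingIdeal_toricVariety,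
    implicitIdeal_eq_latticeIdeal]

theorem isCohnClosure_of_definingIdeal_eq {m n : ℕ} {A : Matrix (Fin m) (Fin n) ℤ[X]}
    {V : DiffVariety.{u} n} (hV : V.definingIdeal = latticeIdeal (kerLattice A)) :
    IsCohnClosure (quasiTorus A) V := by
  have h : V = toricVariety A := by
    rw [← variety_definingIdeal V, hV, ← implicitIdeal_eq_latticeIdeal]
    rfl
  rw [h]
  exact isCohnClosure_toricVariety A

theorem kerLattice_eq_of_rowsGenerate {m n : ℕ} {A : Matrix (Fin m) (Fin n) ℤ[X]}
    {L : ZxLattice n} (hL : IsToricLattice L) (hA : RowsGenerate A (orthComplement L)) :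
    kerLattice A = L := by
  rw [kerLattice_eq_orthComplement hA, orthComplement_orthComplement hL]

theorem exists_kerLattice_eq {n : ℕ} {L : ZxLattice n} (hL : IsToricLattice L) :
    ∃ (m : ℕ) (A : Matrix (Fin m) (Fin n) ℤ[X]), kerLattice A = L ∧ ∀ j, ∃ i, A j i ≠ 0 := by
  obtain ⟨m, A, hA, hrow⟩ := exists_rowsGenerate (orthComplement L)
  exact ⟨m, A, kerLattice_eq_of_rowsGenerate hL hA, hrow⟩

theorem isToric_iff {n : ℕ} (V : DiffVariety.{u} n) : V.IsToric ↔ IsToricIdeal V.definingIdeal := by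
  constructor
  · rintro ⟨m, A, hA⟩
    exact ⟨_, isToricLattice_kerLattice A, definingIdeal_eq_of_isCohnClosure hA⟩
  · rintro ⟨L, hL, hV⟩
    obtain ⟨m, A, rfl, -⟩ := exists_kerLattice_eq hL
    exact ⟨m, A, isCohnClosure_of_definingIdeal_eq hV⟩

theorem exists_noZeroRowCol_isCohnClosure_iff {n : ℕ} (V : DiffVariety.{u} n) :
    (∃ (m : ℕ) (A : Matrix (Fin m) (Fin n) ℤ[X]), NoZeroRowCol A ∧
        IsCohnClosure (quasiTorus A) V) ↔
      ∃ L : ZxLattice n, IsToricLattice L ∧ (∀ i : Fin n, (Pi.single i 1 : Fin n → ℤ[X]) ∉ L) ∧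
        V.definingIdeal = latticeIdeal L := by
  constructor
  · rintro ⟨m, A, hne, hA⟩
    refine ⟨_, isToricLattice_kerLattice A, fun i hi => ?_, definingIdeal_eq_of_isCohnClosure hA⟩
    obtain ⟨j, hj⟩ := hne.2 i
    exact hj ((single_mem_kerLattice_iff A i).1 hi j)
  · rintro ⟨L, hL, hi, hV⟩
    obtain ⟨m, A, rfl, hrow⟩ := exists_kerLattice_eq hL
    refine ⟨m, A, ⟨hrow, fun i => ?_⟩, isCohnClosure_of_definingIdeal_eq hV⟩
    have := hi i
    rwa [single_mem_kerLattice_iff, not_forall] at this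

end DiffToric

theorem mainTheorem10 (n : ℕ) :
    -- a difference variety is toric iff its defining ideal is a toric difference ideal
    (∀ V : DiffToric.DiffVariety.{u} n,
      V.IsToric ↔ DiffToric.IsToricIdeal V.definingIdeal) ∧
    -- the same with the normalization that the defining matrix has no zero row and no zero column
    (∀ V : DiffToric.DiffVariety.{u} n,
      (∃ (m : ℕ) (A : Matrix (Fin m) (Fin n) ℤ[X]), DiffToric.NoZeroRowCol A ∧
          DiffToric.IsCohnClosure (DiffToric.quasiTorus A) V) ↔
        ∃ L : DiffToric.ZxLattice n, DiffToric.IsToricLattice L ∧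
          (∀ i : Fin n, (Pi.single i 1 : Fin n → ℤ[X]) ∉ L) ∧
          V.definingIdeal = DiffToric.latticeIdeal L) ∧
    -- implicitization: the toric variety with defining matrix `A`
    (∀ (m : ℕ) (A : Matrix (Fin m) (Fin n) ℤ[X]),
      DiffToric.IsCohnClosure (DiffToric.quasiTorus A) (DiffToric.toricVariety.{u} A) ∧
      (DiffToric.toricVariety.{u} A).definingIdeal = DiffToric.implicitIdeal A ∧
      DiffToric.IsToricLattice (DiffToric.kerLattice A) ∧
      (DiffToric.toricVariety.{u} A).definingIdeal =
        DiffToric.latticeIdeal (DiffToric.kerLattice A) ∧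
      DiffToric.supportLattice (DiffToric.toricVariety.{u} A).definingIdeal =
        (DiffToric.kerLattice A : Set (Fin n → ℤ[X]))) ∧
    -- parametrization: from a toric lattice `L` to a toric variety
    (∀ L : DiffToric.ZxLattice n, DiffToric.IsToricLattice L →
      L = DiffToric.orthComplement (DiffToric.orthComplement L) ∧
      DiffToric.supportLattice (DiffToric.latticeIdeal L) = (L : Set (Fin n → ℤ[X])) ∧
      (DiffToric.variety.{u} (DiffToric.latticeIdeal L : Set (DiffToric.DiffPoly n))).IsToric ∧
      (DiffToric.variety.{u}
        (DiffToric.latticeIdeal L : Set (DiffToric.DiffPoly n))).definingIdeal =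
          DiffToric.latticeIdeal L ∧
      (∃ (m : ℕ) (A : Matrix (Fin m) (Fin n) ℤ[X]),
        DiffToric.RowsGenerate A (DiffToric.orthComplement L)) ∧
      ∀ (m : ℕ) (A : Matrix (Fin m) (Fin n) ℤ[X]),
        DiffToric.RowsGenerate A (DiffToric.orthComplement L) →
          DiffToric.implicitIdeal A = DiffToric.latticeIdeal L ∧
          DiffToric.toricVariety.{u} A =
            DiffToric.variety.{u} (DiffToric.latticeIdeal L : Set (DiffToric.DiffPoly n))) := by
  refine ⟨DiffToric.isToric_iff, DiffToric.exists_noZeroRowCol_isCohnClosure_iff,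
    fun m A => ?_, fun L hL => ?_⟩
  · have hI := DiffToric.definingIdeal_toricVariety.{u} A
    refine ⟨DiffToric.isCohnClosure_toricVariety A, hI, DiffToric.isToricLattice_kerLattice A,
      ?_, ?_⟩
    · rw [hI, DiffToric.implicitIdeal_eq_latticeIdeal]
    · rw [hI, DiffToric.supportLattice_implicitIdeal]
  -- Only `ker A = L` matters, so this serves both one chosen matrix and every matrix whose rows
  -- generate `Lᶜ`.
  · have hA : ∀ (m : ℕ) (A : Matrix (Fin m) (Fin n) ℤ[X]), DiffToric.kerLattice A = L →
        DiffToric.implicitIdeal A = DiffToric.latticeIdeal L ∧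
        DiffToric.toricVariety.{u} A =
          DiffToric.variety.{u} (DiffToric.latticeIdeal L : Set (DiffToric.DiffPoly n)) := by
      rintro m A rfl
      refine ⟨DiffToric.implicitIdeal_eq_latticeIdeal A, ?_⟩
      rw [← DiffToric.implicitIdeal_eq_latticeIdeal]
      rfl
    obtain ⟨m, A, hker, -⟩ := DiffToric.exists_kerLattice_eq hL
    obtain ⟨hI, hV⟩ := hA m A hker
    refine ⟨(DiffToric.orthComplement_orthComplement hL).symm, ?_, ?_, ?_, ?_, fun m A hrows =>
      hA m A (DiffToric.kerLattice_eq_of_rowsGenerate hL hrows)⟩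
    · rw [← hI, DiffToric.supportLattice_implicitIdeal, hker]
    · rw [← hV]
      exact ⟨m, A, DiffToric.isCohnClosure_toricVariety A⟩
    · rw [← hV, DiffToric.definingIdeal_toricVariety, hI]
    · obtain ⟨k, B, hB, -⟩ := DiffToric.exists_rowsGenerate (DiffToric.orthComplement L)
      exact ⟨k, B, hB⟩
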